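/- **Setup.** Let $\mathbb H$ be the upper half plane, $\Lambda_\tau=\mathbb Z+\mathbb Z\tau$, and let $\mathcal U=(\mathbb H\times\mathbb C)/\mathbb Z^2\to\mathbb H$ be the family of elliptic curves with fibres $E_\tau=\mathbb C/\Lambda_\tau$. The group $T^2=(\mathbb R/\mathbb Z)^2$ acts on $\mathcal U$ by $(\varepsilon_0,\varepsilon_1)\cdot(\tau,z)=(\tau,z+\varepsilon_0+\varepsilon_1\tau)$, and $\Gamma=\mathrm{SL}(2,\mathbb Z)$ acts by $\begin{pmatrix}a&b\\c&d\end{pmatrix}\cdot(\tau,z)=\left(\frac{a\tau+b}{c\tau+d},(c\tau+d)^{-1}z\right)$. Together these give an action on $\mathcal U$ of $A=T^2\rtimes\Gamma$, where $\Gamma$ acts on $T^2$ by $(\varepsilon_0,\varepsilon_1)\mapsto(a\varepsilon_0-b\varepsilon_1,-c\varepsilon_0+d\varepsilon_1)$. The group $A^{(3)}=A^3\rtimes S_3$ acts on $\mathcal U^3\to\mathbb H^3$, where $S_3$ permutes the factors. Let $G\subset A^{(3)}$ be one of the ten groups for which the toroidal orbifold $X=(E_1\times E_2\times E_3)/G$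 has $h^{2,1}(X)=3$. The group $G$ acts trivially on $\mathbb H^3$ and is generated as follows. A triple of symbols describes an action on $(z_1,z_2,z_3)$: $0\pm,1\pm,\tau\pm$ in position $i$ mean $z_i\mapsto\pm z_i$, $\pm z_i+\tfrac12$, $\pm z_i+\tfrac{\tau_i}2$, and symbols without sign denote translations. Put $a=(0+,0-,0-)$, $b=(0-,0+,0-)$, $a'=(1+,0-,0-)$, $b'=(0-,1+,1-)$. The generators are * (0-1): $a,b$; * (0-4): $a',b'$; * (1-1): $a,b,(\tau,\tau,\tau)$; * (1-5): $a',b',(\tau,\tau,\tau)$; * (1-11): $a',b',(\tau,\tau,0)$; * (2-1): $a,b,(1,1,1),(\tau,\tau,\tau)$; * (2-9): $a,b,(0,1,1),(1,0,1)$; * (2-12): $(\tau+,0-,0-),(0-,\tau+,\tau-),(0,1,1),(1,0,1)$; * (3-5): $a,b,(0,1,1),(1,0,1),(\tau,\tau,\tau)$; * (4-1): $a,b,(0,\tau,1),(\tau,1,0),(1,0,\tau),(1,1,1)$. Let $H=N_{A^{(3)}}(G)$ be the normalizer and $H'=H/G$. The group $H'$ acts on $\mathbb H^3$; let $M_X=[\mathbb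 H^3/H']$ be the quotient stack, which describes the moduli stack of complex structures on $X$, and let $\pi:\mathbb H^3\to M_X$ be the projection. A line bundle on $M_X$ is an $H'$-equivariant holomorphic line bundle on $\mathbb H^3$. A trivialization of it is an isomorphism from the trivial bundle (with $H'$ acting through its action on $\mathbb H^3$) that is compatible with the actions of $H'$. The Hodge bundle $\lambda$ on $M_X$ is given by the line bundle $\pi^*\lambda$ on $\mathbb H^3$, the pushforward to $\mathbb H^3$ of the relative canonical bundle $\Omega^3_{\mathcal U^3/\mathbb H^3}$; its fibre at $\tau$ is $H^0(E_{\tau_1}\times E_{\tau_2}\times E_{\tau_3},\Omega^3)$. The action of $H'$ on it is induced by the differentials of the maps by which elements of $H$ act on $\mathcal U^3$ ($G$ acts trivially on this line bundle). Let $\Delta=\eta^{24}$ be the modular discriminant, where $\eta(\tau)=q^{1/24}\prod_{n\ge1}(1-q^n)$, $q=e^{2\pi i\tau}$. **Theorem.** In each of the ten cases, the section $$\sigma=\Bigl(\prod_{i=1}^3\Delta(\tau_i)\Bigr)\,(dz_1\wedge dz_2\wedge dz_3)^{\otimes12}$$ of $(\pi^*\lambda)^{\otimes12}$ over $\mathbb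 H^3$ is holomorphic, $H'$-equivariant and nowhere vanishing. Hence it descends to a trivialization of $\lambda^{\otimes12}$ over $M_X$: there is an isomorphism $\mathcal O_{M_X}\to\lambda^{\otimes12}$ that maps $1$ to $\sigma$. -/

import Mathlib

open scoped Topology TensorProduct MatrixGroups UpperHalfPlane

noncomputable section

namespace ToroidalOrbifold

/-! ### The family of elliptic curves and the groups acting on it -/

/-- The product `ℍ³` of three upper half planes. -/
abbrev H3 : Type := Fin 3 → ℍ

/-- The complex vector space `ℂ³`, with coordinates `z₁, z₂, z₃`. -/
abbrev C3 : Type := Fin 3 → ℂ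

/-- `Γ = SL(2, ℤ)`; it acts on `ℍ` by fractional linear transformations. -/
abbrev Gam : Type := SL(2, ℤ)

/-- The lattice `Λ_τ = ℤ + ℤτ` in `ℂ`. -/
def lat (τ : ℍ) : AddSubgroup ℂ := AddSubgroup.closure {1, (τ : ℂ)}

/-- The elliptic curve `E_τ = ℂ / Λ_τ`. -/
abbrev Ell (τ : ℍ) : Type := ℂ ⧸ lat τ

/-- The family `𝒰 = (ℍ × ℂ) / ℤ²` of elliptic curves over `ℍ`, as a set: the union of its
fibres `E_τ`. -/
abbrev Univ : Type := Σ τ : ℍ, Ell τ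

/-- The class `[τ, z]` in `𝒰` of a point `(τ, z)` of `ℍ × ℂ`. -/
def pt (τ : ℍ) (z : ℂ) : Univ := ⟨τ, (z : Ell τ)⟩

/-- The factor of automorphy `cτ + d`. -/
def aut (γ : Gam) (τ : ℍ) : ℂ := (γ 1 0 : ℂ) * τ + (γ 1 1 : ℂ)

theorem aut_ne_zero (γ : Gam) (τ : ℍ) : aut γ τ ≠ 0 := by
  have := UpperHalfPlane.denom_ne_zero (γ : GL (Fin 2) ℝ) τ
  simpa [aut, ModularGroup.denom_apply] using this

theorem coe_smul_eq (γ : Gam) (τ : ℍ) :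
    ((γ • τ : ℍ) : ℂ) = ((γ 0 0 : ℂ) * τ + (γ 0 1 : ℂ)) / aut γ τ := by
  rw [UpperHalfPlane.coe_specialLinearGroup_apply]
  simp [aut]

theorem det_eq (γ : Gam) : (γ 0 0 : ℂ) * γ 1 1 - γ 0 1 * γ 1 0 = 1 := by
  have h := γ.det_coe
  rw [Matrix.det_fin_two] at h
  exact_mod_cast h

theorem aut_one (τ : ℍ) : aut 1 τ = 1 := by simp [aut]

theorem aut_mul (γ δ : Gam) (τ : ℍ) : aut (γ * δ) τ = aut γ (δ • τ) * aut δ τ := by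
  have h := aut_ne_zero δ τ
  rw [aut, aut, coe_smul_eq]
  field_simp
  simp only [aut, Matrix.SpecialLinearGroup.coe_mul, Matrix.mul_apply, Fin.sum_univ_two]
  push_cast
  ring

theorem one_mem_lat (τ : ℍ) : (1 : ℂ) ∈ lat τ := AddSubgroup.subset_closure (by simp)

theorem tau_mem_lat (τ : ℍ) : (τ : ℂ) ∈ lat τ := AddSubgroup.subset_closure (by simp)

theorem int_comb_mem_lat (τ : ℍ) (m n : ℤ) : (m : ℂ) + n * τ ∈ lat τ := by
  have h := (lat τ).add_mem ((lat τ).zsmul_mem (one_mem_lat τ) m)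
    ((lat τ).zsmul_mem (tau_mem_lat τ) n)
  simpa using h

/-- The isomorphism `E_τ → E_{γτ}` induced by `z ↦ (cτ + d)⁻¹ z`. -/
def ellMap (γ : Gam) (τ : ℍ) : Ell τ →+ Ell (γ • τ) :=
  QuotientAddGroup.map (lat τ) (lat (γ • τ)) (AddMonoidHom.mulLeft (aut γ τ)⁻¹) (by
    have h := aut_ne_zero γ τ
    have hd := det_eq γ
    rw [lat, AddSubgroup.closure_le]
    rintro x (rfl | rfl)
    · have e : (aut γ τ)⁻¹ * 1 = ((γ 0 0 : ℤ) : ℂ) + ((-γ 1 0 : ℤ) : ℂ) * ((γ • τ : ℍ) : ℂ) := by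
        rw [coe_smul_eq]
        field_simp
        rw [aut]
        push_cast
        linear_combination -hd
      change (aut γ τ)⁻¹ * 1 ∈ lat (γ • τ)
      rw [e]
      exact int_comb_mem_lat _ _ _
    · have e : (aut γ τ)⁻¹ * (τ : ℂ) =
          ((-γ 0 1 : ℤ) : ℂ) + ((γ 1 1 : ℤ) : ℂ) * ((γ • τ : ℍ) : ℂ) := by
        rw [coe_smul_eq]
        field_simp
        rw [aut]
        push_cast
        linear_combination -(τ : ℂ) * hd
      change (aut γ τ)⁻¹ * (τ : ℂ) ∈ lat (γ • τ)
      rw [e]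
      exact int_comb_mem_lat _ _ _)

/-- The real torus `T² = (ℝ/ℤ)²`, written multiplicatively. -/
def T2 : Type := Multiplicative (Fin 2 → UnitAddCircle)

instance : CommGroup T2 := inferInstanceAs (CommGroup (Multiplicative (Fin 2 → UnitAddCircle)))

/-- The element `(x, y)` of `T²`. -/
def T2.mk (x y : UnitAddCircle) : T2 := Multiplicative.ofAdd ![x, y]

/-- The two coordinates of an element of `T²`. -/
def T2.coord (ε : T2) : Fin 2 → UnitAddCircle := Multiplicative.toAdd ε

theorem T2.coord_mk (x y : UnitAddCircle) : (T2.mk x y).coord = ![x, y] := rfl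

theorem T2.coord_mul (ε δ : T2) : (ε * δ).coord = ε.coord + δ.coord := rfl

theorem T2.coord_one : (1 : T2).coord = 0 := rfl

theorem T2.ext {ε δ : T2} (h : ε.coord = δ.coord) : ε = δ := h

theorem T2.exists_rep (ε : T2) : ∃ x y : ℝ, ε = T2.mk (x : UnitAddCircle) (y : UnitAddCircle) := by
  obtain ⟨x, hx⟩ := QuotientAddGroup.mk_surjective (ε.coord 0)
  obtain ⟨y, hy⟩ := QuotientAddGroup.mk_surjective (ε.coord 1)
  refine ⟨x, y, T2.ext ?_⟩
  funext i
  fin_cases i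
  · exact hx.symm
  · exact hy.symm

theorem T2.mk_mul (x y p q : UnitAddCircle) : T2.mk x y * T2.mk p q = T2.mk (x + p) (y + q) := by
  apply T2.ext
  funext i
  rw [T2.coord_mul]
  fin_cases i <;> rfl

theorem T2.mk_zero : T2.mk 0 0 = 1 := by
  apply T2.ext
  funext i
  fin_cases i <;> rfl

theorem T2.eq_mk (ε : T2) : ∃ x y : UnitAddCircle, ε = T2.mk x y := by
  obtain ⟨x, y, h⟩ := ε.exists_rep
  exact ⟨_, _, h⟩

/-- The element `(a ε₀ - b ε₁, -c ε₀ + d ε₁)` of `T²`. -/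
def actT (γ : Gam) (ε : T2) : T2 :=
  T2.mk (γ 0 0 • ε.coord 0 - γ 0 1 • ε.coord 1) (-(γ 1 0 • ε.coord 0) + γ 1 1 • ε.coord 1)

theorem actT_mk (γ : Gam) (x y : UnitAddCircle) :
    actT γ (T2.mk x y) = T2.mk (γ 0 0 • x - γ 0 1 • y) (-(γ 1 0 • x) + γ 1 1 • y) := rfl

/-- `Γ` acts on `T²` by `γ · (ε₀, ε₁) = (a ε₀ - b ε₁, -c ε₀ + d ε₁)`. This is conjugation by `γ`
inside the group of transformations of `𝒰`. -/
instance : MulDistribMulAction Gam T2 where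
  smul := actT
  one_smul ε := by
    obtain ⟨x, y, rfl⟩ := ε.eq_mk
    change actT _ _ = _
    rw [actT_mk]
    simp
  mul_smul γ δ ε := by
    obtain ⟨x, y, rfl⟩ := ε.eq_mk
    change actT _ _ = actT _ (actT _ _)
    simp only [actT_mk, Matrix.SpecialLinearGroup.coe_mul, Matrix.mul_apply, Fin.sum_univ_two]
    congr 1 <;> module
  smul_mul γ ε δ := by
    obtain ⟨x, y, rfl⟩ := ε.eq_mk
    obtain ⟨p, q, rfl⟩ := δ.eq_mk
    change actT _ _ = actT _ _ * actT _ _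
    simp only [actT_mk, T2.mk_mul]
    congr 1 <;> module
  smul_one γ := by
    change actT γ 1 = 1
    rw [← T2.mk_zero, actT_mk]
    simp

theorem smul_mk (γ : Gam) (x y : UnitAddCircle) :
    γ • T2.mk x y = T2.mk (γ 0 0 • x - γ 0 1 • y) (-(γ 1 0 • x) + γ 1 1 • y) := rfl

/-- For `c ∈ Λ_τ`, the homomorphism `ℝ/ℤ → E_τ`, `x ↦ x c`. -/
def circleMap (τ : ℍ) (c : ℂ) (hc : c ∈ lat τ) : UnitAddCircle →+ Ell τ :=
  QuotientAddGroup.map (AddSubgroup.zmultiples (1 : ℝ)) (lat τ)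
    ((AddMonoidHom.mulRight c).comp Complex.ofRealHom.toAddMonoidHom) (by
      rw [AddSubgroup.zmultiples_le]
      change ((1 : ℝ) : ℂ) * c ∈ lat τ
      simpa using hc)

/-- The point `ε₀ + ε₁ τ` of `E_τ`. -/
def shift (τ : ℍ) (ε : T2) : Ell τ :=
  circleMap τ 1 (one_mem_lat τ) (ε.coord 0) + circleMap τ τ (tau_mem_lat τ) (ε.coord 1)

theorem shift_mk (τ : ℍ) (x y : ℝ) :
    shift τ (T2.mk (x : UnitAddCircle) (y : UnitAddCircle)) = ((x + y * τ : ℂ) : Ell τ) := by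
  change (((x : ℂ) * 1 : ℂ) : Ell τ) + (((y : ℂ) * τ : ℂ) : Ell τ) = _
  rw [mul_one]
  rfl

/-- The group `A = T² ⋊ Γ`. -/
abbrev AGrp : Type := T2 ⋊[MulDistribMulAction.toMulAut Gam T2] Gam

/-- `A` acts on `ℍ` through `Γ`. -/
instance : MulAction AGrp ℍ where
  smul a τ := a.right • τ
  one_smul τ := one_smul Gam τ
  mul_smul a b τ := mul_smul a.right b.right τ

/-- The action of `a = (ε, γ)` on fibres, `E_τ → E_{γτ}`,
`z ↦ (cτ + d)⁻¹ z + ε₀ + ε₁ · γτ`. -/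
def fibA (a : AGrp) (τ : ℍ) (x : Ell τ) : Ell (a • τ) :=
  ellMap a.right τ x + shift (a.right • τ) a.left

/-- The value of the action of `A` on `𝒰`. -/
def smulU (a : AGrp) (u : Univ) : Univ := ⟨a • u.1, fibA a u.1 u.2⟩

theorem smulU_pt (x y : ℝ) (γ : Gam) (τ : ℍ) (z : ℂ) :
    smulU ⟨T2.mk (x : UnitAddCircle) (y : UnitAddCircle), γ⟩ (pt τ z) =
      pt (γ • τ) ((aut γ τ)⁻¹ * z + (x + y * ((γ • τ : ℍ) : ℂ))) := by
  have h : fibA ⟨T2.mk (x : UnitAddCircle) (y : UnitAddCircle), γ⟩ τ (z : Ell τ) =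
      (((aut γ τ)⁻¹ * z + (x + y * ((γ • τ : ℍ) : ℂ)) : ℂ) : Ell (γ • τ)) := by
    change ellMap γ τ z + shift (γ • τ) (T2.mk x y) = _
    rw [shift_mk]
    rfl
  exact congrArg (Sigma.mk (γ • τ)) h

/-- `A` acts on `𝒰`: translations by `(ε₀, ε₁) · [τ, z] = [τ, z + ε₀ + ε₁ τ]`, and
`γ · [τ, z] = [γτ, (cτ + d)⁻¹ z]`. -/
instance : MulAction AGrp Univ where
  smul := smulU
  one_smul u := by
    obtain ⟨τ, x⟩ := u
    obtain ⟨z, rfl⟩ := QuotientAddGroup.mk_surjective x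
    have h := smulU_pt 0 0 1 τ z
    have e : (⟨T2.mk ((0 : ℝ) : UnitAddCircle) ((0 : ℝ) : UnitAddCircle), 1⟩ : AGrp) = 1 := by
      refine SemidirectProduct.ext ?_ rfl
      apply T2.ext
      funext i
      fin_cases i <;> rfl
    rw [e] at h
    change smulU 1 (pt τ z) = pt τ z
    rw [h, one_smul, aut_one]
    simp
  mul_smul a b u := by
    obtain ⟨τ, w⟩ := u
    obtain ⟨z, rfl⟩ := QuotientAddGroup.mk_surjective w
    obtain ⟨ε, γ⟩ := a
    obtain ⟨δ, ρ⟩ := b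
    obtain ⟨x, y, rfl⟩ := ε.exists_rep
    obtain ⟨p, q, rfl⟩ := δ.exists_rep
    change smulU (_ * _) (pt τ z) = smulU _ (smulU _ (pt τ z))
    have e : (⟨T2.mk (x : UnitAddCircle) (y : UnitAddCircle), γ⟩ *
        ⟨T2.mk (p : UnitAddCircle) (q : UnitAddCircle), ρ⟩ : AGrp) =
        ⟨T2.mk ((x + (γ 0 0 * p - γ 0 1 * q) : ℝ) : UnitAddCircle)
          ((y + (-(γ 1 0 * p) + γ 1 1 * q) : ℝ) : UnitAddCircle), γ * ρ⟩ := by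
      refine SemidirectProduct.ext ?_ rfl
      change T2.mk _ _ * (γ • T2.mk _ _) = _
      rw [smul_mk]
      apply T2.ext
      funext i
      rw [T2.coord_mul]
      fin_cases i
      · simp [T2.coord_mk, ← zsmul_eq_mul]
      · simp [T2.coord_mk, ← zsmul_eq_mul]
    rw [e, smulU_pt, smulU_pt, smulU_pt, mul_smul, aut_mul]
    congr 1
    have h1 := aut_ne_zero ρ τ
    have h2 := aut_ne_zero γ (ρ • τ)
    rw [coe_smul_eq γ (ρ • τ)]
    have hd := det_eq γ
    have h3 : aut γ (ρ • τ) = (γ 1 0 : ℂ) * ((ρ • τ : ℍ) : ℂ) + (γ 1 1 : ℂ) := rfl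
    push_cast
    field_simp
    rw [h3]
    linear_combination ((p : ℂ) + q * ((ρ • τ : ℍ) : ℂ)) * aut ρ τ * hd

/-- The group `A⁽³⁾ = A³ ⋊ S₃`. -/
abbrev A3Grp : Type :=
  (Fin 3 → AGrp) ⋊[mulAutArrow (G := Equiv.Perm (Fin 3)) (A := Fin 3) (M := AGrp)]
    Equiv.Perm (Fin 3)

theorem A3Grp.mul_left_apply (h k : A3Grp) (i : Fin 3) :
    (h * k).left i = h.left i * k.left (h.right⁻¹ i) := rfl

/-- `A⁽³⁾` acts on `𝒰³`: `A³` acts factorwise and `S₃` permutes the three factors. -/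
instance : MulAction A3Grp (Fin 3 → Univ) where
  smul h u i := h.left i • u (h.right⁻¹ i)
  one_smul u := by
    funext i
    exact one_smul AGrp (u i)
  mul_smul h k u := by
    funext i
    change (h * k).left i • u ((h.right * k.right)⁻¹ i) =
      h.left i • k.left (h.right⁻¹ i) • u (k.right⁻¹ (h.right⁻¹ i))
    rw [A3Grp.mul_left_apply, mul_smul, mul_inv_rev]
    rfl

/-- `A⁽³⁾` acts on `ℍ³` compatibly with the projection `𝒰³ → ℍ³`. -/
instance : MulAction A3Grp H3 where
  smul h τ i := h.left i • τ (h.right⁻¹ i)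
  one_smul τ := by
    funext i
    exact one_smul AGrp (τ i)
  mul_smul h k τ := by
    funext i
    change (h * k).left i • τ ((h.right * k.right)⁻¹ i) =
      h.left i • k.left (h.right⁻¹ i) • τ (k.right⁻¹ (h.right⁻¹ i))
    rw [A3Grp.mul_left_apply, mul_smul, mul_inv_rev]
    rfl

/-- The fibre `Y_τ = E_{τ₁} × E_{τ₂} × E_{τ₃}` of `𝒰³ → ℍ³`. -/
abbrev YFib (τ : H3) : Type := ∀ i, Ell (τ i)

/-- The universal covering `ℂ³ → Y_τ`. -/
def cov (τ : H3) (z : C3) : YFib τ := fun i => (z i : Ell (τ i))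

/-- The inclusion of the fibre `Y_τ` in `𝒰³`. -/
def incl (τ : H3) (y : YFib τ) : Fin 3 → Univ := fun i => ⟨τ i, y i⟩

/-- The map `Y_τ → Y_{hτ}` between fibres of `𝒰³` given by the action of `h ∈ A⁽³⁾`. -/
def fibMap (h : A3Grp) (τ : H3) (y : YFib τ) : YFib (h • τ) :=
  fun i => fibA (h.left i) (τ (h.right⁻¹ i)) (y (h.right⁻¹ i))

theorem incl_fibMap (h : A3Grp) (τ : H3) (y : YFib τ) :
    incl (h • τ) (fibMap h τ y) = h • incl τ y := rfl

/-- The differential of the map `Y_τ → Y_{hτ}` given by `h ∈ A⁽³⁾`. All tangent spaces of `Y_τ` are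
`ℂ³`, and the map is covered by an affine map with this linear part. -/
def dfib (h : A3Grp) (τ : H3) : C3 →L[ℂ] C3 :=
  ContinuousLinearMap.pi fun i =>
    (aut (h.left i).right (τ (h.right⁻¹ i)))⁻¹ •
      (ContinuousLinearMap.proj (R := ℂ) (φ := fun _ : Fin 3 => ℂ) (h.right⁻¹ i))

theorem dfib_apply (h : A3Grp) (τ : H3) (v : C3) (i : Fin 3) :
    dfib h τ v i = (aut (h.left i).right (τ (h.right⁻¹ i)))⁻¹ * v (h.right⁻¹ i) := rfl

/-- The action of `h` on the fibre over `τ` is covered by an affine map `ℂ³ → ℂ³`, whose derivative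
is `dfib h τ` everywhere. -/
theorem exists_lift (h : A3Grp) (τ : H3) :
    ∃ g : C3 → C3, (∀ z, fibMap h τ (cov τ z) = cov (h • τ) (g z)) ∧
      ∀ z, HasFDerivAt g (dfib h τ) z := by
  have key : ∀ i, ∃ c : ℂ, (c : Ell ((h • τ) i)) =
      shift ((h.left i).right • τ (h.right⁻¹ i)) (h.left i).left := fun i =>
    QuotientAddGroup.mk_surjective _
  choose c hc using key
  refine ⟨fun z => dfib h τ z + c, fun z => ?_, fun z =>
    ((dfib h τ).hasFDerivAt).add_const c⟩
  funext i
  change ellMap _ _ _ + shift _ _ = _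
  rw [← hc i]
  rfl

theorem dfib_one (τ : H3) : dfib 1 τ = ContinuousLinearMap.id ℂ C3 := by
  ext v i
  rw [dfib_apply]
  change (aut 1 _)⁻¹ * v i = v i
  rw [aut_one]
  simp

theorem dfib_mul (h k : A3Grp) (τ : H3) :
    dfib (h * k) τ = (dfib h (k • τ)).comp (dfib k τ) := by
  ext v i
  rw [ContinuousLinearMap.comp_apply, dfib_apply, dfib_apply, dfib_apply, A3Grp.mul_left_apply]
  change (aut ((h.left i).right * (k.left (h.right⁻¹ i)).right)
    (τ ((h.right * k.right)⁻¹ i)))⁻¹ * v ((h.right * k.right)⁻¹ i) = _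
  rw [mul_inv_rev, aut_mul, mul_inv, mul_assoc]
  rfl

/-! ### Holomorphic three-forms on the fibres -/

/-- The space of alternating `ℂ`-trilinear forms on `ℂ³`. -/
abbrev Alt3 : Type := C3 [⋀^Fin 3]→L[ℂ] ℂ

/-- The alternating form `dz₁ ∧ dz₂ ∧ dz₃` on `ℂ³`, that is `(v₁, v₂, v₃) ↦ det (v₁, v₂, v₃)`. -/
def dzAlt : Alt3 :=
  { (Matrix.detRowAlternating : (Fin 3 → ℂ) [⋀^Fin 3]→ₗ[ℂ] ℂ) with
    cont := by
      change Continuous fun v : Fin 3 → Fin 3 → ℂ => Matrix.det (Matrix.of v)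
      exact Continuous.matrix_det (by fun_prop) }

theorem dzAlt_apply (v : Fin 3 → C3) : dzAlt v = Matrix.det (Matrix.of v) := rfl

/-- The space `H⁰(Y_τ, Ω³)` of holomorphic three-forms on the complex torus `Y_τ`. As the tangent
bundle of `Y_τ` is `Y_τ × ℂ³`, a three-form is a function on `Y_τ` with values in the alternating
forms on `ℂ³`; it is holomorphic if its pullback to the covering `ℂ³` is. -/
def Forms (τ : H3) : Submodule ℂ (YFib τ → Alt3) where
  carrier := {ω | Differentiable ℂ fun z : C3 => ω (cov τ z)}
  add_mem' ha hb := ha.add hb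
  zero_mem' := differentiable_const (0 : Alt3)
  smul_mem' c _ ha := ha.const_smul c

/-- The holomorphic three-form `dz₁ ∧ dz₂ ∧ dz₃` on `Y_τ`. -/
def dz (τ : H3) : Forms τ := ⟨fun _ => dzAlt, differentiable_const dzAlt⟩

/-- The pullback `h^* : H⁰(Y_{hτ}, Ω³) → H⁰(Y_τ, Ω³)` of forms by the action of `h ∈ A⁽³⁾`:
`(h^* ω)_y (v₁, v₂, v₃) = ω_{hy} (dh v₁, dh v₂, dh v₃)`. -/
def pullForm (h : A3Grp) (τ : H3) : Forms (h • τ) →ₗ[ℂ] Forms τ where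
  toFun ω := ⟨fun y => (ω.1 (fibMap h τ y)).compContinuousLinearMap (dfib h τ), by
    obtain ⟨g, hg, hd⟩ := exists_lift h τ
    change Differentiable ℂ fun z => (ω.1 (fibMap h τ (cov τ z))).compContinuousLinearMap _
    simp only [hg]
    have h1 : Differentiable ℂ fun z => ω.1 (cov (h • τ) (g z)) :=
      ω.2.comp fun z => (hd z).differentiableAt
    exact (ContinuousAlternatingMap.compContinuousLinearMapCLM (dfib h τ)).differentiable.comp h1⟩
  map_add' _ _ := rfl
  map_smul' _ _ := rfl

/-- Every point of `Y_τ` has a representative in a bounded subset of `ℂ³`. -/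
theorem exists_bounded_rep (τ : H3) : ∃ R : ℝ, ∀ z : C3, ∃ z' : C3, cov τ z' = cov τ z ∧
    ‖z'‖ ≤ R := by
  refine ⟨∑ i, (1 + ‖(τ i : ℂ)‖), fun z => ?_⟩
  have key : ∀ i, ∃ w : ℂ, (w : Ell (τ i)) = (z i : Ell (τ i)) ∧ ‖w‖ ≤ 1 + ‖(τ i : ℂ)‖ := by
    intro i
    have him : (τ i).im ≠ 0 := (τ i).im_ne_zero
    set y : ℝ := (z i).im / (τ i).im with hy
    set x : ℝ := (z i).re - y * (τ i).re with hx
    have hz : z i = x + y * (τ i : ℂ) := by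
      apply Complex.ext
      · simp [hx]
      · simp [hy, him]
    refine ⟨Int.fract x + Int.fract y * (τ i : ℂ), ?_, ?_⟩
    · rw [eq_comm, QuotientAddGroup.eq_iff_sub_mem]
      have e : z i - ((Int.fract x : ℝ) + (Int.fract y : ℝ) * (τ i : ℂ)) =
          ((⌊x⌋ : ℤ) : ℂ) + ((⌊y⌋ : ℤ) : ℂ) * (τ i : ℂ) := by
        rw [hz, Int.fract, Int.fract]
        push_cast
        ring
      rw [e]
      exact int_comb_mem_lat _ _ _
    · have hf : ∀ t : ℝ, ‖((Int.fract t : ℝ) : ℂ)‖ ≤ 1 := fun t => by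
        rw [Complex.norm_real, Real.norm_eq_abs, abs_of_nonneg (Int.fract_nonneg t)]
        exact (Int.fract_lt_one t).le
      calc _ ≤ ‖((Int.fract x : ℝ) : ℂ)‖ + ‖((Int.fract y : ℝ) : ℂ) * (τ i : ℂ)‖ := norm_add_le _ _
        _ ≤ 1 + 1 * ‖(τ i : ℂ)‖ := by
          rw [norm_mul]
          gcongr
          · exact hf x
          · exact hf y
        _ = _ := by ring
  choose w hw hb using key
  refine ⟨w, funext hw, ?_⟩
  rw [pi_norm_le_iff_of_nonneg (by positivity)]
  intro i
  refine (hb i).trans ?_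
  exact Finset.single_le_sum (f := fun i => 1 + ‖(τ i : ℂ)‖) (fun j _ => by positivity)
    (Finset.mem_univ i)

/-- Holomorphic three-forms on `Y_τ` have constant coefficients. -/
theorem form_const {τ : H3} (ω : Forms τ) (y y' : YFib τ) : ω.1 y = ω.1 y' := by
  obtain ⟨R, hR⟩ := exists_bounded_rep τ
  have hb : Bornology.IsBounded (Set.range fun z : C3 => ω.1 (cov τ z)) := by
    have hc : IsCompact ((fun z : C3 => ω.1 (cov τ z)) '' Metric.closedBall 0 R) :=
      (isCompact_closedBall _ _).image ω.2.continuous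
    refine hc.isBounded.subset ?_
    rintro _ ⟨z, rfl⟩
    obtain ⟨z', h1, h2⟩ := hR z
    exact ⟨z', by simpa using h2, by simp only [h1]⟩
  have hs : Function.Surjective (cov τ) := fun y => by
    choose z hz using fun i => QuotientAddGroup.mk_surjective (y i)
    exact ⟨z, funext hz⟩
  obtain ⟨z, rfl⟩ := hs y
  obtain ⟨z', rfl⟩ := hs y'
  exact ω.2.apply_eq_apply_of_bounded hb z z'

/-- The coefficient `c` of a form `c dz₁ ∧ dz₂ ∧ dz₃` on `Y_τ`. -/
def coef (τ : H3) : Forms τ →ₗ[ℂ] ℂ where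
  toFun ω := ω.1 0 (fun i => Pi.single i 1)
  map_add' _ _ := rfl
  map_smul' _ _ := rfl

theorem alt_eq (α : Alt3) : α = α (fun i => Pi.single i 1) • dzAlt := by
  apply ContinuousAlternatingMap.toAlternatingMap_injective
  refine Module.Basis.ext_alternating (Pi.basisFun ℂ (Fin 3)) fun v hv => ?_
  obtain ⟨p, rfl⟩ : ∃ p : Equiv.Perm (Fin 3), v = p :=
    ⟨Equiv.ofBijective v (Finite.injective_iff_bijective.mp hv), rfl⟩
  have e : (fun i => Pi.basisFun ℂ (Fin 3) (p i)) =
      (fun i => (Pi.single i (1 : ℂ) : C3)) ∘ p := by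
    funext i
    simp
  rw [e]
  change α ((fun i => (Pi.single i (1 : ℂ) : C3)) ∘ p) = _ * dzAlt (_ ∘ p)
  have h1 := α.toAlternatingMap.map_perm (fun i => (Pi.single i (1 : ℂ) : C3)) p
  have h2 := dzAlt.toAlternatingMap.map_perm (fun i => (Pi.single i (1 : ℂ) : C3)) p
  have h3 : dzAlt (fun i => (Pi.single i (1 : ℂ) : C3)) = 1 := by
    rw [dzAlt_apply]
    have : Matrix.of (fun i => (Pi.single i (1 : ℂ) : C3)) = 1 := by
      ext i j
      simp [Matrix.one_apply, Pi.single_apply, eq_comm]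
    rw [this, Matrix.det_one]
  change α _ = _ at h1
  change dzAlt _ = _ • dzAlt _ at h2
  rw [h1, h2, h3]
  simp [mul_comm, Units.smul_def]

theorem coef_dz (τ : H3) : coef τ (dz τ) = 1 := by
  change Matrix.det (Matrix.of (fun i => (Pi.single i (1 : ℂ) : C3))) = 1
  have : Matrix.of (fun i => (Pi.single i (1 : ℂ) : C3)) = 1 := by
    ext i j
    simp [Matrix.one_apply, Pi.single_apply, eq_comm]
  rw [this, Matrix.det_one]

theorem coef_smul_dz {τ : H3} (ω : Forms τ) : coef τ ω • dz τ = ω := by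
  apply Subtype.ext
  funext y
  change ω.1 0 (fun i => Pi.single i 1) • dzAlt = ω.1 y
  rw [← alt_eq, form_const ω y 0]

/-- The determinant of the differential of `h` along the fibre over `τ`. -/
def jac (h : A3Grp) (τ : H3) : ℂ :=
  (Equiv.Perm.sign h.right : ℤ) * ∏ i, (aut (h.left i).right (τ (h.right⁻¹ i)))⁻¹

theorem coef_pullForm (h : A3Grp) (τ : H3) (ω : Forms (h • τ)) :
    coef τ (pullForm h τ ω) = jac h τ * coef (h • τ) ω := by
  conv_lhs => rw [← coef_smul_dz ω]
  rw [map_smul, map_smul, smul_eq_mul, mul_comm]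
  congr 1
  change dzAlt (fun i => dfib h τ (Pi.single i 1)) = jac h τ
  rw [dzAlt_apply]
  have e : Matrix.of (fun i => dfib h τ (Pi.single i 1)) =
      Matrix.of fun i j => (aut (h.left j).right (τ (h.right⁻¹ j)))⁻¹ *
        (h.right.permMatrix ℂ) i j := by
    ext i j
    simp only [Matrix.of_apply, dfib_apply, Equiv.Perm.permMatrix, PEquiv.toMatrix_apply,
      Pi.single_apply]
    congr 1
    simp [Equiv.eq_symm_apply, eq_comm]
  rw [e, Matrix.det_mul_row, Matrix.det_permutation, jac, mul_comm]

/-! ### Holomorphic functions on `ℍ³` -/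

/-- The coordinates on `ℍ³`, as the inclusion `ℍ³ → ℂ³`. -/
def toC (τ : H3) : C3 := fun i => (τ i : ℂ)

/-- The inverse of the inclusion `ℍ³ → ℂ³` (with a default value outside of `ℍ³`). -/
def ofC (w : C3) : H3 := fun i => UpperHalfPlane.ofComplex (w i)

theorem ofC_toC (τ : H3) : ofC (toC τ) = τ := by
  funext i
  exact UpperHalfPlane.ofComplex_apply (τ i)

theorem continuous_toC : Continuous toC := by
  unfold toC
  fun_prop

theorem tendsto_ofC (τ : H3) : Filter.Tendsto ofC (𝓝 (toC τ)) (𝓝 τ) := by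
  rw [tendsto_pi_nhds]
  intro i
  have h1 : Filter.Tendsto UpperHalfPlane.ofComplex (𝓝 (τ i : ℂ)) (𝓝 (τ i)) := by
    have h := (UpperHalfPlane.mdifferentiableAt_ofComplex (τ i).im_pos).continuousAt
    simpa [ContinuousAt, UpperHalfPlane.ofComplex_apply] using h
  exact h1.comp ((continuous_apply i).tendsto (toC τ))

theorem eventually_toC_ofC (τ : H3) : ∀ᶠ w in 𝓝 (toC τ), toC (ofC w) = w := by
  have h : ∀ i, ∀ᶠ w : C3 in 𝓝 (toC τ), 0 < (w i).im := fun i =>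
    (Complex.continuous_im.comp (continuous_apply i)).continuousAt.eventually
      (lt_mem_nhds (τ i).im_pos)
  filter_upwards [Filter.eventually_all.2 h] with w hw
  funext i
  simp [toC, ofC, UpperHalfPlane.ofComplex_apply_of_im_pos (hw i)]

/-- The function `f` is holomorphic in a neighbourhood of the point `τ` of `ℍ³`. -/
def HolFunAt (f : H3 → ℂ) (τ : H3) : Prop := AnalyticAt ℂ (fun w : C3 => f (ofC w)) (toC τ)

theorem HolFunAt.congr {f g : H3 → ℂ} {τ : H3} (h : HolFunAt f τ) (e : ∀ᶠ x in 𝓝 τ, f x = g x) :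
    HolFunAt g τ :=
  AnalyticAt.congr h ((tendsto_ofC τ).eventually e)

theorem HolFunAt.eventually {f : H3 → ℂ} {τ : H3} (h : HolFunAt f τ) :
    ∀ᶠ x in 𝓝 τ, HolFunAt f x :=
  (continuous_toC.tendsto τ).eventually h.eventually_analyticAt

theorem HolFunAt.mul {f g : H3 → ℂ} {τ : H3} (hf : HolFunAt f τ) (hg : HolFunAt g τ) :
    HolFunAt (fun x => f x * g x) τ := AnalyticAt.mul hf hg

theorem HolFunAt.sum {ι : Type} (t : Finset ι) {f : ι → H3 → ℂ} {τ : H3}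
    (hf : ∀ j ∈ t, HolFunAt (f j) τ) : HolFunAt (fun x => ∑ j ∈ t, f j x) τ :=
  Finset.analyticAt_fun_sum t hf

theorem HolFunAt.prod {ι : Type} (t : Finset ι) {f : ι → H3 → ℂ} {τ : H3}
    (hf : ∀ j ∈ t, HolFunAt (f j) τ) : HolFunAt (fun x => ∏ j ∈ t, f j x) τ :=
  Finset.analyticAt_fun_prod t hf

theorem holFunAt_const (c : ℂ) (τ : H3) : HolFunAt (fun _ => c) τ := analyticAt_const

/-- The group `K` acts on `ℍ³` by holomorphic maps. -/
class HolAction (K : Type) [Group K] [MulAction K H3] : Prop where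
  cont : ∀ k : K, Continuous fun τ : H3 => k • τ
  hol : ∀ (k : K) (f : H3 → ℂ) (τ : H3), HolFunAt f (k • τ) → HolFunAt (fun x => f (k • x)) τ

/-! ### Line bundles on quotient stacks -/

/-- A holomorphic line bundle on the quotient stack `[ℍ³/K]`, that is a `K`-equivariant holomorphic
line bundle on `ℍ³`. The data are the fibres `Fib τ`, the notion of a section that is holomorphic
in a neighbourhood of a point, and the action of `K`, given by the linear maps
`pull k τ = k^* : Fib (kτ) → Fib τ`. The bundle is locally trivial: in a neighbourhood of each point
there is a section `e` that is a basis of each fibre, such that the holomorphic sections are the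
products `f e` with `f` holomorphic. -/
structure StackLineBundle (K : Type) [Group K] [MulAction K H3] where
  Fib : H3 → Type
  [addCommGroup : ∀ τ, AddCommGroup (Fib τ)]
  [module : ∀ τ, Module ℂ (Fib τ)]
  HolAt : (∀ τ, Fib τ) → H3 → Prop
  frame : ∀ τ₀ : H3, ∃ (e : ∀ τ, Fib τ) (W : Set H3), IsOpen W ∧ τ₀ ∈ W ∧
    (∀ τ ∈ W, ∀ v : Fib τ, ∃! c : ℂ, c • e τ = v) ∧
    ∀ s : ∀ τ, Fib τ, ∀ τ ∈ W,
      (HolAt s τ ↔ ∃ f : H3 → ℂ, HolFunAt f τ ∧ ∀ᶠ x in 𝓝 τ, s x = f x • e x)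
  pull : ∀ (k : K) (τ : H3), Fib (k • τ) →ₗ[ℂ] Fib τ
  pull_one : ∀ (s : ∀ τ, Fib τ) (τ : H3), pull 1 τ (s ((1 : K) • τ)) = s τ
  pull_mul : ∀ (k l : K) (s : ∀ τ, Fib τ) (τ : H3),
    pull (k * l) τ (s ((k * l) • τ)) = pull l τ (pull k (l • τ) (s (k • l • τ)))
  pull_hol : ∀ (k : K) (s : ∀ τ, Fib τ) (τ : H3), HolAt s (k • τ) →
    HolAt (fun x => pull k x (s (k • x))) τ

attribute [instance] StackLineBundle.addCommGroup StackLineBundle.module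

namespace StackLineBundle

variable {K : Type} [Group K] [MulAction K H3]

/-- The section `s` over `ℍ³` is holomorphic. -/
def IsHolomorphic (L : StackLineBundle K) (s : ∀ τ, L.Fib τ) : Prop := ∀ τ, L.HolAt s τ

/-- The section `s` over `ℍ³` is `K`-equivariant: `k^* (s (kτ)) = s τ`. -/
def IsEquivariant (L : StackLineBundle K) (s : ∀ τ, L.Fib τ) : Prop :=
  ∀ (k : K) (τ : H3), L.pull k τ (s (k • τ)) = s τ

/-- The trivial line bundle `𝒪` on `[ℍ³/K]`. -/
def trivial (K : Type) [Group K] [MulAction K H3] [HolAction K] : StackLineBundle K where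
  Fib _ := ℂ
  HolAt := HolFunAt
  frame _ := ⟨fun _ => 1, Set.univ, isOpen_univ, Set.mem_univ _, fun _ _ v =>
    ⟨v, mul_one v, fun c hc => (mul_one c).symm.trans hc⟩, fun s _ _ =>
    ⟨fun h => ⟨s, h, Filter.Eventually.of_forall fun x => (mul_one (s x)).symm⟩,
      fun ⟨_, hf, e⟩ => hf.congr (e.mono fun _ hx => (hx.trans (mul_one _)).symm)⟩⟩
  pull _ _ := LinearMap.id
  pull_one s τ := congrArg s (one_smul K τ)
  pull_mul k l s τ := congrArg s (mul_smul k l τ)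
  pull_hol k s τ h := HolAction.hol k s τ h

/-- Isomorphisms of line bundles on `[ℍ³/K]`. -/
structure Iso (L M : StackLineBundle K) where
  toEquiv : ∀ τ, L.Fib τ ≃ₗ[ℂ] M.Fib τ
  hol_iff : ∀ (s : ∀ τ, L.Fib τ) (τ : H3), L.HolAt s τ ↔ M.HolAt (fun x => toEquiv x (s x)) τ
  comm : ∀ (k : K) (τ : H3) (v : L.Fib (k • τ)),
    toEquiv τ (L.pull k τ v) = M.pull k τ (toEquiv (k • τ) v)

theorem eq_of_sections {F : H3 → Type} [∀ τ, AddCommGroup (F τ)] [∀ τ, Module ℂ (F τ)]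
    {a b : H3} (hab : a = b) {V : Type} [AddCommGroup V] [Module ℂ V]
    (f : F a →ₗ[ℂ] V) (g : F b →ₗ[ℂ] V) (h : ∀ s : ∀ τ, F τ, f (s a) = g (s b)) : HEq f g := by
  subst hab
  apply heq_of_eq
  apply LinearMap.ext
  intro v
  classical
  simpa using h (Function.update 0 a v)

theorem map_eq_of_sections {F : H3 → Type} [∀ τ, AddCommGroup (F τ)] [∀ τ, Module ℂ (F τ)]
    {a b : H3} (hab : a = b) {V : Type} [AddCommGroup V] [Module ℂ V]
    (f : F a →ₗ[ℂ] V) (g : F b →ₗ[ℂ] V) (h : ∀ s : ∀ τ, F τ, f (s a) = g (s b)) (n : ℕ)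
    (t : ∀ τ, ⨂[ℂ] (_ : Fin n), F τ) :
    PiTensorProduct.map (fun _ => f) (t a) = PiTensorProduct.map (fun _ => g) (t b) := by
  have e := eq_of_sections hab f g h
  subst hab
  rw [eq_of_heq e]

/-- The tensor power `L^{⊗n}`. A section of it is holomorphic at a point if near this point it is a
finite sum of products `g s₁ ⊗ ⋯ ⊗ sₙ` with a holomorphic function `g` and holomorphic sections `sᵢ`
of `L`. -/
def tensorPower [HolAction K] (L : StackLineBundle K) (n : ℕ) : StackLineBundle K where
  Fib τ := ⨂[ℂ] (_ : Fin n), L.Fib τ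
  HolAt t τ := ∃ (m : ℕ) (g : Fin m → H3 → ℂ) (s : Fin m → Fin n → ∀ x, L.Fib x),
    (∀ j, HolFunAt (g j) τ) ∧ (∀ j i, L.HolAt (s j i) τ) ∧
    ∀ᶠ x in 𝓝 τ, t x = ∑ j, g j x • PiTensorProduct.tprod ℂ (fun i => s j i x)
  frame τ₀ := by
    obtain ⟨e, W, hW, h0, hb, hh⟩ := L.frame τ₀
    refine ⟨fun τ => PiTensorProduct.tprod ℂ fun _ => e τ, W, hW, h0, fun τ hτ v => ?_,
      fun t τ hτ => ⟨?_, ?_⟩⟩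
    · choose φ hφ hu using hb τ hτ
      let φL : L.Fib τ →ₗ[ℂ] ℂ :=
        { toFun := φ
          map_add' := fun v w => (hu (v + w) (φ v + φ w) (by
            change (φ v + φ w) • e τ = v + w
            rw [add_smul]
            exact congrArg₂ _ (hφ v) (hφ w))).symm
          map_smul' := fun c v => (hu (c • v) (c * φ v) (by
            change (c * φ v) • e τ = c • v
            rw [mul_smul]
            exact congrArg _ (hφ v))).symm }
      let Φ : (⨂[ℂ] (_ : Fin n), L.Fib τ) →ₗ[ℂ] ℂ :=
        PiTensorProduct.lift ((MultilinearMap.mkPiAlgebra ℂ (Fin n) ℂ).compLinearMap fun _ => φL)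
      have h1 : φ (e τ) = 1 := (hu (e τ) 1 (one_smul ℂ _)).symm
      have hΦ : Φ (PiTensorProduct.tprod ℂ fun _ => e τ) = 1 := by
        change PiTensorProduct.lift _ _ = _
        rw [PiTensorProduct.lift.tprod]
        change (MultilinearMap.mkPiAlgebra ℂ (Fin n) ℂ) (fun _ => φ (e τ)) = 1
        rw [h1]
        simp
      have hsp : ∀ v, Φ v • (PiTensorProduct.tprod ℂ fun _ => e τ) = v := by
        intro v
        induction v using PiTensorProduct.induction_on with
        | smul_tprod r f =>
          rw [map_smul]
          change (r • PiTensorProduct.lift _ _) • _ = _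
          rw [PiTensorProduct.lift.tprod]
          change (r • (MultilinearMap.mkPiAlgebra ℂ (Fin n) ℂ) (fun i => φ (f i))) • _ = _
          rw [MultilinearMap.mkPiAlgebra_apply, smul_assoc, ← MultilinearMap.map_smul_univ]
          congr 2
          funext i
          exact hφ (f i)
        | add x y hx hy => rw [map_add, add_smul, hx, hy]
      refine ⟨Φ v, hsp v, fun c hc => ?_⟩
      have h2 := congrArg Φ hc
      change Φ (c • _) = _ at h2
      rw [map_smul, hΦ, smul_eq_mul, mul_one] at h2
      exact h2
    · rintro ⟨m, g, s, hg, hs, ht⟩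
      choose f hf hfe using fun j i => (hh (s j i) τ hτ).1 (hs j i)
      refine ⟨fun x => ∑ j, g j x * ∏ i, f j i x,
        HolFunAt.sum _ fun j _ => (hg j).mul (HolFunAt.prod _ fun i _ => hf j i), ?_⟩
      filter_upwards [ht, Filter.eventually_all.2 fun j => Filter.eventually_all.2 fun i => hfe j i]
        with x hx hx'
      rw [hx, Finset.sum_smul]
      refine Finset.sum_congr rfl fun j _ => ?_
      rw [mul_smul, ← MultilinearMap.map_smul_univ]
      congr 2
      funext i
      exact hx' j i
    · rintro ⟨f, hf, hfe⟩
      refine ⟨1, fun _ => f, fun _ _ => e, fun _ => hf, fun _ _ => ?_, ?_⟩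
      · exact (hh e τ hτ).2 ⟨fun _ => 1, holFunAt_const 1 τ,
          Filter.Eventually.of_forall fun x => (one_smul ℂ _).symm⟩
      · filter_upwards [hfe] with x hx
        rw [hx, Fin.sum_univ_one]
  pull k τ := PiTensorProduct.map fun _ => L.pull k τ
  pull_one t τ := by
    rw [map_eq_of_sections (F := L.Fib) (one_smul K τ) (L.pull 1 τ) LinearMap.id
      (fun s => L.pull_one s τ) n t, PiTensorProduct.map_id]
    rfl
  pull_mul k l t τ := by
    rw [map_eq_of_sections (F := L.Fib) (mul_smul k l τ) (L.pull (k * l) τ)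
      (L.pull l τ ∘ₗ L.pull k (l • τ)) (fun s => L.pull_mul k l s τ) n t,
      PiTensorProduct.map_comp]
    rfl
  pull_hol k t τ := by
    rintro ⟨m, g, s, hg, hs, ht⟩
    refine ⟨m, fun j x => g j (k • x), fun j i x => L.pull k x (s j i (k • x)),
      fun j => HolAction.hol k (g j) τ (hg j), fun j i => L.pull_hol k (s j i) τ (hs j i), ?_⟩
    filter_upwards [((HolAction.cont k).tendsto τ).eventually ht] with x hx
    rw [hx, map_sum]
    refine Finset.sum_congr rfl fun j _ => ?_
    rw [map_smul, PiTensorProduct.map_tprod]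

/-- The restriction of a `K`-equivariant line bundle to a subgroup, that is its pullback to
`[ℍ³/S]`. -/
def restrict (L : StackLineBundle K) (S : Subgroup K) : StackLineBundle S where
  Fib := L.Fib
  HolAt := L.HolAt
  frame := L.frame
  pull k τ := L.pull (k : K) τ
  pull_one := L.pull_one
  pull_mul k l := L.pull_mul (k : K) (l : K)
  pull_hol k := L.pull_hol (k : K)

/-- If a normal subgroup `N` of `K` acts trivially on `ℍ³`, then `K/N` acts on `ℍ³`. -/
@[reducible]
def quotAction (N : Subgroup K) [N.Normal] (h : ∀ n ∈ N, ∀ τ : H3, n • τ = τ) :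
    MulAction (K ⧸ N) H3 where
  smul q τ := Quotient.liftOn' q (fun k => k • τ) fun a b hab => by
    have h1 := h _ (QuotientGroup.leftRel_apply.1 hab) τ
    rw [mul_smul, inv_smul_eq_iff] at h1
    exact h1.symm
  one_smul τ := one_smul K τ
  mul_smul p q τ := by
    induction p using QuotientGroup.induction_on with | H k => ?_
    induction q using QuotientGroup.induction_on with | H l => ?_
    exact mul_smul k l τ

/-- The action of the class of `k` in `K/N` on the fibres of a `K`-equivariant line bundle on which
`N` acts trivially, defined as the action of `k`. -/
def quotPull (L : StackLineBundle K) (N : Subgroup K) [N.Normal]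
    (h : ∀ n ∈ N, ∀ τ : H3, n • τ = τ)
    (hL : ∀ n ∈ N, ∀ (s : ∀ τ, L.Fib τ) (τ : H3), L.pull n τ (s (n • τ)) = s τ)
    (q : K ⧸ N) (τ : H3) :
    letI := quotAction N h
    L.Fib (q • τ) →ₗ[ℂ] L.Fib τ :=
  letI := quotAction N h
  Quotient.hrecOn (motive := fun q : K ⧸ N => L.Fib (q • τ) →ₗ[ℂ] L.Fib τ) q
    (fun k => L.pull k τ) fun a b hab => by
      have hn := QuotientGroup.leftRel_apply.1 hab
      obtain ⟨n, hn', rfl⟩ : ∃ n ∈ N, b = a * n := ⟨a⁻¹ * b, hn, by group⟩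
      refine eq_of_sections (F := L.Fib) ?_ _ _ fun s => ?_
      · rw [mul_smul, h n hn']
      · rw [L.pull_mul]
        exact (hL n hn' (fun x => L.pull a x (s (a • x))) τ).symm

/-- If a normal subgroup `N` of `K` acts trivially on `ℍ³` and on the fibres of a `K`-equivariant
line bundle, then this line bundle is `K/N`-equivariant: the class of `k` acts as `k` does. -/
def descend (L : StackLineBundle K) (N : Subgroup K) [N.Normal]
    (h : ∀ n ∈ N, ∀ τ : H3, n • τ = τ)
    (hL : ∀ n ∈ N, ∀ (s : ∀ τ, L.Fib τ) (τ : H3), L.pull n τ (s (n • τ)) = s τ) :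
    @StackLineBundle (K ⧸ N) _ (quotAction N h) :=
  letI := quotAction N h
  { Fib := L.Fib
    HolAt := L.HolAt
    frame := L.frame
    pull := L.quotPull N h hL
    pull_one := fun s τ => L.pull_one s τ
    pull_mul := fun p q s τ => by
      induction p using QuotientGroup.induction_on with | H k => ?_
      induction q using QuotientGroup.induction_on with | H l => ?_
      exact L.pull_mul k l s τ
    pull_hol := fun q s τ => by
      induction q using QuotientGroup.induction_on with | H k => ?_
      exact L.pull_hol k s τ }

end StackLineBundle

instance (S : Subgroup A3Grp) [h : HolAction A3Grp] : HolAction S where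
  cont k := h.cont (k : A3Grp)
  hol k := h.hol (k : A3Grp)

/-! ### The Hodge bundle -/

theorem holFunAt_coord (i : Fin 3) (τ : H3) : HolFunAt (fun x => (x i : ℂ)) τ := by
  have h : AnalyticAt ℂ (fun w : C3 => w i) (toC τ) :=
    (ContinuousLinearMap.proj (R := ℂ) (φ := fun _ : Fin 3 => ℂ) i).analyticAt _
  refine h.congr ?_
  filter_upwards [eventually_toC_ofC τ] with w hw
  exact (congrFun hw i).symm

theorem holFunAt_aut (γ : Gam) (i : Fin 3) (τ : H3) : HolFunAt (fun x => aut γ (x i)) τ :=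
  (analyticAt_const.mul (holFunAt_coord i τ)).add analyticAt_const

theorem holFunAt_aut_inv (γ : Gam) (i : Fin 3) (τ : H3) :
    HolFunAt (fun x => (aut γ (x i))⁻¹) τ :=
  AnalyticAt.inv (holFunAt_aut γ i τ) (by
    rw [ofC_toC]
    exact aut_ne_zero γ (τ i))

instance : HolAction A3Grp where
  cont h := by
    refine continuous_pi fun i => ?_
    change Continuous fun τ : H3 => (h.left i).right • τ (h.right⁻¹ i)
    refine Continuous.comp ?_ (continuous_apply _)
    rw [UpperHalfPlane.isEmbedding_coe.continuous_iff]
    have e : (UpperHalfPlane.coe ∘ fun x : ℍ => (h.left i).right • x) = fun x : ℍ =>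
        ((((h.left i).right 0 0 : ℤ) : ℂ) * (x : ℂ) + (((h.left i).right 0 1 : ℤ) : ℂ)) /
          aut (h.left i).right x := by
      funext x
      exact coe_smul_eq _ x
    rw [e]
    refine Continuous.div (by fun_prop) ?_ (aut_ne_zero _)
    unfold aut
    fun_prop
  hol h f τ hf := by
    have hc : AnalyticAt ℂ (fun w : C3 => toC (h • ofC w)) (toC τ) := by
      rw [analyticAt_pi_iff]
      intro i
      have h1 : HolFunAt (fun x => ((((h.left i).right 0 0 : ℤ) : ℂ) * (x (h.right⁻¹ i) : ℂ) +
          (((h.left i).right 0 1 : ℤ) : ℂ)) * (aut (h.left i).right (x (h.right⁻¹ i)))⁻¹) τ :=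
        ((analyticAt_const.mul (holFunAt_coord _ τ)).add analyticAt_const).mul
          (holFunAt_aut_inv _ _ τ)
      refine AnalyticAt.congr h1 (Filter.Eventually.of_forall fun w => ?_)
      exact ((coe_smul_eq _ _).trans (div_eq_mul_inv _ _)).symm
    have hf' : AnalyticAt ℂ (fun w : C3 => f (ofC w)) (toC (h • ofC (toC τ))) := by
      rw [ofC_toC]
      exact hf
    have h2 := AnalyticAt.fun_comp (f := fun w : C3 => toC (h • ofC w)) (x := toC τ) hf' hc
    refine AnalyticAt.congr h2 (Filter.Eventually.of_forall fun w => ?_)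
    simp only [ofC_toC]

/-- A section `s` of `τ ↦ H⁰(Y_τ, Ω³)` is a relative three-form on `𝒰³ → ℍ³`. It is holomorphic at
`τ` as a section of the pushforward of `Ω³` of `𝒰³ / ℍ³` if, in a neighbourhood of the fibre over
`τ`, it is holomorphic as a form on `𝒰³`, that is, in the coordinates `(τ, z)`. -/
def FormsHolAt (s : ∀ τ, Forms τ) (τ : H3) : Prop :=
  ∀ᶠ x in 𝓝 τ, ∀ z : C3,
    AnalyticAt ℂ (fun p : C3 × C3 => (s (ofC p.1)).1 (cov (ofC p.1) p.2)) (toC x, z)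

theorem formsHolAt_iff (s : ∀ τ, Forms τ) (τ : H3) :
    FormsHolAt s τ ↔ HolFunAt (fun x => coef x (s x)) τ := by
  constructor
  · intro h
    have h1 := h.self_of_nhds 0
    have h2 : AnalyticAt ℂ (fun w : C3 => ((w, 0) : C3 × C3)) (toC τ) :=
      analyticAt_id.prod analyticAt_const
    have h3 := AnalyticAt.fun_comp (f := fun w : C3 => ((w, 0) : C3 × C3)) (x := toC τ) h1 h2
    exact ((ContinuousAlternatingMap.apply ℂ C3 ℂ
      (fun i : Fin 3 => (Pi.single i 1 : C3))).analyticAt _).fun_comp h3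
  · intro h
    filter_upwards [h.eventually] with x hx z
    have h1 : AnalyticAt ℂ (fun p : C3 × C3 => coef (ofC p.1) (s (ofC p.1)) • dzAlt) (toC x, z) :=
      (AnalyticAt.fun_comp (f := fun p : C3 × C3 => p.1) (x := (toC x, z)) hx analyticAt_fst).smul
        analyticAt_const
    refine h1.congr (Filter.Eventually.of_forall fun p => ?_)
    exact congrArg (fun ω : Forms (ofC p.1) => ω.1 (cov (ofC p.1) p.2))
      (coef_smul_dz (s (ofC p.1)))

theorem fibMap_comp_section (h k : A3Grp) (s : ∀ τ, Forms τ) (τ : H3) (y : YFib τ) :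
    (s ((h * k) • τ)).1 (fibMap (h * k) τ y) =
      (s (h • k • τ)).1 (fibMap h (k • τ) (fibMap k τ y)) := by
  have e : incl _ (fibMap (h * k) τ y) = incl _ (fibMap h (k • τ) (fibMap k τ y)) := by
    rw [incl_fibMap, incl_fibMap, incl_fibMap, mul_smul]
  exact congrArg (fun u : Fin 3 → Univ => (s fun i => (u i).1).1 fun i => (u i).2) e

theorem fibMap_one_section (s : ∀ τ, Forms τ) (τ : H3) (y : YFib τ) :
    (s ((1 : A3Grp) • τ)).1 (fibMap 1 τ y) = (s τ).1 y := by
  have e : incl _ (fibMap 1 τ y) = incl _ y := by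
    rw [incl_fibMap, one_smul]
  exact congrArg (fun u : Fin 3 → Univ => (s fun i => (u i).1).1 fun i => (u i).2) e

/-- The pushforward to `ℍ³` of the relative canonical bundle of `𝒰³ → ℍ³`, with fibres
`H⁰(Y_τ, Ω³)`, as an `A⁽³⁾`-equivariant line bundle: `A⁽³⁾` acts by the differential of its action
on `𝒰³`. -/
def hodgeA3 : StackLineBundle A3Grp where
  Fib τ := Forms τ
  HolAt := FormsHolAt
  frame τ₀ := by
    refine ⟨dz, Set.univ, isOpen_univ, Set.mem_univ _, fun τ _ ω => ⟨coef τ ω, coef_smul_dz ω,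
      fun c hc => ?_⟩, fun s τ _ => ⟨fun h => ⟨fun x => coef x (s x), (formsHolAt_iff s τ).1 h,
        Filter.Eventually.of_forall fun x => (coef_smul_dz (s x)).symm⟩, ?_⟩⟩
    · have := congrArg (coef τ) hc
      simpa [coef_dz] using this
    · rintro ⟨f, hf, e⟩
      rw [formsHolAt_iff]
      refine hf.congr (e.mono fun x hx => ?_)
      rw [hx, map_smul, coef_dz, smul_eq_mul, mul_one]
  pull := pullForm
  pull_one s τ := by
    apply Subtype.ext
    funext y
    change ((s ((1 : A3Grp) • τ)).1 (fibMap 1 τ y)).compContinuousLinearMap (dfib 1 τ) = _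
    rw [fibMap_one_section, dfib_one]
    rfl
  pull_mul h k s τ := by
    apply Subtype.ext
    funext y
    change ((s ((h * k) • τ)).1 (fibMap (h * k) τ y)).compContinuousLinearMap (dfib (h * k) τ) = _
    rw [fibMap_comp_section, dfib_mul]
    rfl
  pull_hol h s τ hs := by
    rw [formsHolAt_iff] at hs ⊢
    simp only [coef_pullForm]
    refine HolFunAt.mul (HolFunAt.mul (holFunAt_const _ τ) ?_) (HolAction.hol h _ τ hs)
    exact HolFunAt.prod _ fun i _ => holFunAt_aut_inv _ _ τ

/-! ### The ten toroidal orbifolds with `h^{2,1} = 3` -/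

/-- The ten families of toroidal orbifolds `X = (E₁ × E₂ × E₃)/G` with `h^{2,1}(X) = 3` in the
classification of Donagi and Wendland; `r` and `i` in the label `(r-i)` are the rank of the group of
shifts and a serial number. -/
inductive OrbifoldCase : Type
  | c0_1 | c0_4 | c1_1 | c1_5 | c1_11 | c2_1 | c2_9 | c2_12 | c3_5 | c4_1

/-- The half period `1/2`, as an element of `T²`. -/
def halfOne : T2 := T2.mk ((1 / 2 : ℝ) : UnitAddCircle) 0

/-- The half period `τ/2`, as an element of `T²`. -/
def halfTau : T2 := T2.mk 0 ((1 / 2 : ℝ) : UnitAddCircle)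

/-- The transformation `z ↦ z + ε` of the elliptic curves, as an element of `A`. -/
def plus (ε : T2) : AGrp := ⟨ε, 1⟩

/-- The transformation `z ↦ -z + ε` of the elliptic curves, as an element of `A`. -/
def minus (ε : T2) : AGrp := ⟨ε, -1⟩

/-- The shift by `(ε₁, ε₂, ε₃)`. -/
def shift3 (ε₁ ε₂ ε₃ : T2) : A3Grp := ⟨![plus ε₁, plus ε₂, plus ε₃], 1⟩

/-- The twist `(z₁ + ε₁, -z₂ + ε₂, -z₃ + ε₃)`. -/
def twistA (ε₁ ε₂ ε₃ : T2) : A3Grp := ⟨![plus ε₁, minus ε₂, minus ε₃], 1⟩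

/-- The twist `(-z₁ + ε₁, z₂ + ε₂, -z₃ + ε₃)`. -/
def twistB (ε₁ ε₂ ε₃ : T2) : A3Grp := ⟨![minus ε₁, plus ε₂, minus ε₃], 1⟩

/-- The generators of the group `G`. The first two are the generators of the twist group `G_T`, the
others are generators of the shift group `G_S`. Here `1 : T2` is the zero translation. -/
def gens : OrbifoldCase → Set A3Grp
  | .c0_1 => {twistA 1 1 1, twistB 1 1 1}
  | .c0_4 => {twistA halfOne 1 1, twistB 1 halfOne halfOne}
  | .c1_1 => {twistA 1 1 1, twistB 1 1 1, shift3 halfTau halfTau halfTau}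
  | .c1_5 => {twistA halfOne 1 1, twistB 1 halfOne halfOne, shift3 halfTau halfTau halfTau}
  | .c1_11 => {twistA halfOne 1 1, twistB 1 halfOne halfOne, shift3 halfTau halfTau 1}
  | .c2_1 => {twistA 1 1 1, twistB 1 1 1, shift3 halfOne halfOne halfOne,
      shift3 halfTau halfTau halfTau}
  | .c2_9 => {twistA 1 1 1, twistB 1 1 1, shift3 1 halfOne halfOne, shift3 halfOne 1 halfOne}
  | .c2_12 => {twistA halfTau 1 1, twistB 1 halfTau halfTau, shift3 1 halfOne halfOne,
      shift3 halfOne 1 halfOne}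
  | .c3_5 => {twistA 1 1 1, twistB 1 1 1, shift3 1 halfOne halfOne, shift3 halfOne 1 halfOne,
      shift3 halfTau halfTau halfTau}
  | .c4_1 => {twistA 1 1 1, twistB 1 1 1, shift3 1 halfTau halfOne, shift3 halfTau halfOne 1,
      shift3 halfOne 1 halfTau, shift3 halfOne halfOne halfOne}

/-- The group `G`, as a subgroup of `A⁽³⁾`. -/
def G (X : OrbifoldCase) : Subgroup A3Grp := Subgroup.closure (gens X)

/-- The normalizer `H` of `G` in `A⁽³⁾`. -/
def H (X : OrbifoldCase) : Subgroup A3Grp := Subgroup.normalizer (G X : Set A3Grp)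

/-- `G` as a subgroup of `H`. -/
def GH (X : OrbifoldCase) : Subgroup (H X) := (G X).subgroupOf (H X)

instance (X : OrbifoldCase) : (GH X).Normal := by
  unfold GH H
  infer_instance

/-- The quotient `H' = H/G`. -/
abbrev HQuot (X : OrbifoldCase) : Type := H X ⧸ GH X

/-- The element `g` acts trivially on `ℍ³` and on the fibres of the Hodge bundle. -/
def ActsTrivially (g : A3Grp) : Prop :=
  (∀ τ : H3, g • τ = τ) ∧
    ∀ (s : ∀ τ, hodgeA3.Fib τ) (τ : H3), hodgeA3.pull g τ (s (g • τ)) = s τ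

theorem pullForm_of_jac (g : A3Grp) (h : ∀ τ : H3, g • τ = τ) (hj : ∀ τ, jac g τ = 1)
    (s : ∀ τ, Forms τ) (τ : H3) : pullForm g τ (s (g • τ)) = s τ := by
  rw [← coef_smul_dz (pullForm g τ (s (g • τ))), coef_pullForm, hj, one_mul]
  have e : coef (g • τ) (s (g • τ)) = coef τ (s τ) := congrArg (fun x => coef x (s x)) (h τ)
  rw [e]
  exact coef_smul_dz (s τ)

theorem actsTrivially_of_jac (g : A3Grp) (h : ∀ τ : H3, g • τ = τ) (hj : ∀ τ, jac g τ = 1) :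
    ActsTrivially g :=
  ⟨h, pullForm_of_jac g h hj⟩

theorem neg_one_smul_tau (τ : ℍ) : (-1 : Gam) • τ = τ := by
  rw [ModularGroup.SL_neg_smul, one_smul]

theorem aut_neg_one (τ : ℍ) : aut (-1) τ = -1 := by simp [aut]

theorem actsTrivially_gen (X : OrbifoldCase) (g : A3Grp) (hg : g ∈ gens X) : ActsTrivially g := by
  have key : (∃ a b c, g = shift3 a b c) ∨ (∃ a b c, g = twistA a b c) ∨
      (∃ a b c, g = twistB a b c) := by
    cases X <;> simp only [gens, Set.mem_insert_iff, Set.mem_singleton_iff] at hg <;> grind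
  rcases key with ⟨a, b, c, rfl⟩ | ⟨a, b, c, rfl⟩ | ⟨a, b, c, rfl⟩
  · refine actsTrivially_of_jac _ (fun τ => funext fun i => ?_) fun τ => ?_
    · fin_cases i <;> exact one_smul Gam _
    · rw [jac, Fin.prod_univ_three]
      simp [shift3, plus, aut_one]
  · refine actsTrivially_of_jac _ (fun τ => funext fun i => ?_) fun τ => ?_
    · fin_cases i
      · exact one_smul Gam _
      · exact neg_one_smul_tau _
      · exact neg_one_smul_tau _
    · rw [jac, Fin.prod_univ_three]
      simp [twistA, plus, minus, aut_one, aut_neg_one]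
  · refine actsTrivially_of_jac _ (fun τ => funext fun i => ?_) fun τ => ?_
    · fin_cases i
      · exact neg_one_smul_tau _
      · exact one_smul Gam _
      · exact neg_one_smul_tau _
    · rw [jac, Fin.prod_univ_three]
      simp [twistB, plus, minus, aut_one, aut_neg_one]

theorem actsTrivially_G (X : OrbifoldCase) (g : A3Grp) (hg : g ∈ G X) : ActsTrivially g := by
  induction hg using Subgroup.closure_induction with
  | mem x hx => exact actsTrivially_gen X x hx
  | one => exact ⟨fun τ => one_smul _ τ, hodgeA3.pull_one⟩
  | mul x y _ _ hx hy =>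
    refine ⟨fun τ => by rw [mul_smul, hy.1, hx.1], fun s τ => ?_⟩
    rw [hodgeA3.pull_mul]
    exact (hy.2 (fun z => hodgeA3.pull x z (s (x • z))) τ).trans (hx.2 s τ)
  | inv x _ hx =>
    refine ⟨fun τ => by rw [inv_smul_eq_iff, hx.1], fun s τ => ?_⟩
    have h1 := hx.2 (fun z => hodgeA3.pull x⁻¹ z (s (x⁻¹ • z))) τ
    have h2 := hodgeA3.pull_mul x⁻¹ x s τ
    have h3 : hodgeA3.pull (x⁻¹ * x) τ (s ((x⁻¹ * x) • τ)) = s τ := by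
      rw [inv_mul_cancel]
      exact hodgeA3.pull_one s τ
    exact h1.symm.trans (h2.symm.trans h3)

/-- `H' = H/G` acts on `ℍ³` through `H`. -/
instance (X : OrbifoldCase) : MulAction (HQuot X) H3 :=
  StackLineBundle.quotAction (GH X) fun n hn τ => (actsTrivially_G X n hn).1 τ

instance (X : OrbifoldCase) : HolAction (HQuot X) where
  cont q := by
    induction q using QuotientGroup.induction_on with | H k => ?_
    exact HolAction.cont k
  hol q := by
    induction q using QuotientGroup.induction_on with | H k => ?_
    exact HolAction.hol k

/-- The Hodge bundle `λ` over `M_X = [ℍ³/H']`: the pushforward of the relative canonical bundle of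
`𝒰³ → ℍ³`, on which `H' = H/G` acts by the differential of the action of `H` on `𝒰³`. -/
def hodgeBundle (X : OrbifoldCase) : StackLineBundle (HQuot X) :=
  (hodgeA3.restrict (H X)).descend (GH X) (fun n hn τ => (actsTrivially_G X n hn).1 τ)
    fun n hn s τ => (actsTrivially_G X n hn).2 s τ

/-- The section `(∏ᵢ Δ(τᵢ)) (dz₁ ∧ dz₂ ∧ dz₃)^{⊗12}` of the pullback of `λ^{⊗12}` to `ℍ³`, where
`Δ = η²⁴` is the modular discriminant. -/
def discSection (X : OrbifoldCase) (τ : H3) : ((hodgeBundle X).tensorPower 12).Fib τ :=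
  (∏ i, ModularForm.discriminant (τ i)) •
    PiTensorProduct.tprod ℂ fun _ : Fin 12 => (dz τ : (hodgeBundle X).Fib τ)

end ToroidalOrbifold

namespace ToroidalOrbifold

/-! The discriminant is a modular form of weight 12 for `SL(2, ℤ)` without zeros on `ℍ`, and its
weight is matched to the twelfth power of the Hodge bundle. An element `h` of `A⁽³⁾` acts on a fibre
by an affine map. Its translations do not affect `dz₁ ∧ dz₂ ∧ dz₃`, so pulling this form back
multiplies it by the determinant `jac h τ` of the linear part: the sign of the permutation times the
product of the inverse automorphy factors `(cτ + d)⁻¹`. In the twelfth tensor power the sign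
disappears and each factor `(cτ + d)⁻¹²` cancels the weight of the corresponding discriminant; the
permutation of the three factors only reorders the product. This is `prod_discriminant_smul`,
combined with `pullForm_dz`.

The computation holds for every element of `A⁽³⁾`, so nothing has to be known about the normalizer
`H`, and the ten cases need no separate treatment. The group `G` enters only through its trivial
action on `ℍ³` and on the Hodge bundle, which lets the action of `H` pass to `H/G`.

The remaining step is general: a nowhere vanishing, equivariant holomorphic section of a line bundle
trivializes it (`isoOfSection`). -/

/-! ### Weight of the discriminant against the Jacobian of the action -/

/-- The matrices `S` and `T` generate `SL(2, ℤ)`, so invariance of the discriminant under the weight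
12 slash action of these two gives invariance under every `γ`. -/
theorem discriminant_smul (γ : Gam) (τ : ℍ) :
    ModularForm.discriminant (γ • τ) = aut γ τ ^ 12 * ModularForm.discriminant τ := by
  have h := congrFun (SlashInvariantForm.slash_action_generators_SL2Z
    ModularForm.discriminant_S_invariant ModularForm.discriminant_T_invariant γ) τ
  rw [ModularForm.SL_slash_apply, zpow_neg, ModularGroup.denom_apply] at h
  -- Definitional unfolding turns the integer power of the denominator into a natural power of `aut
  -- γ τ`.
  have h' : ModularForm.discriminant (γ • τ) * (aut γ τ ^ 12)⁻¹ = ModularForm.discriminant τ := h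
  rw [mul_inv_eq_iff_eq_mul₀ (pow_ne_zero _ (aut_ne_zero γ τ))] at h'
  rw [h', mul_comm]

/-- A complex differentiable function on an open subset of `ℂ` is analytic; composing with the
coordinate projection `ℂ³ → ℂ` gives analyticity in three variables. -/
theorem holFunAt_discriminant (i : Fin 3) (τ : H3) :
    HolFunAt (fun x => ModularForm.discriminant (x i)) τ := by
  have h : AnalyticAt ℂ (fun z => ModularForm.discriminant (UpperHalfPlane.ofComplex z))
      (τ i : ℂ) :=
    (UpperHalfPlane.mdifferentiable_iff.1 CuspForm.discriminant.holo').analyticAt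
      (UpperHalfPlane.isOpen_upperHalfPlaneSet.mem_nhds (τ i).im_pos)
  exact AnalyticAt.fun_comp (f := fun w : C3 => w i) (x := toC τ) h
    ((ContinuousLinearMap.proj (R := ℂ) (φ := fun _ : Fin 3 => ℂ) i).analyticAt _)

/-- An even power removes the sign of the permutation, which is the only part of `jac` that
discriminants could not compensate. -/
theorem jac_pow_twelve (h : A3Grp) (τ : H3) :
    jac h τ ^ 12 = ∏ i, (aut (h.left i).right (τ (h.right⁻¹ i)) ^ 12)⁻¹ := by
  have hs : ((Equiv.Perm.sign h.right : ℤ) : ℂ) ^ 12 = 1 := by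
    rcases Int.units_eq_one_or (Equiv.Perm.sign h.right) with e | e <;> norm_num [e]
  rw [jac, mul_pow, hs, one_mul, ← Finset.prod_pow]
  exact Finset.prod_congr rfl fun i _ => inv_pow _ _

theorem prod_discriminant_smul (h : A3Grp) (τ : H3) :
    (∏ i, ModularForm.discriminant ((h • τ) i)) * jac h τ ^ 12 =
      ∏ i, ModularForm.discriminant (τ i) := by
  -- The product on the right is reindexed by `h.right⁻¹`, so that the `i`-th factors on both sides
  -- involve the same point `τ (h.right⁻¹ i)` and can be compared one by one.
  rw [jac_pow_twelve, ← Finset.prod_mul_distrib,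
    ← Equiv.prod_comp h.right⁻¹ fun i => ModularForm.discriminant (τ i)]
  refine Finset.prod_congr rfl fun i _ => ?_
  change ModularForm.discriminant ((h.left i).right • τ (h.right⁻¹ i)) * _ = _
  have ha : aut (h.left i).right (τ (h.right⁻¹ i)) ^ 12 ≠ 0 := pow_ne_zero _ (aut_ne_zero _ _)
  rw [discriminant_smul, mul_comm, inv_mul_cancel_left₀ ha]

/-- A holomorphic three-form on a complex torus is determined by its constant coefficient, so it
suffices to compare coefficients. -/
theorem pullForm_dz (h : A3Grp) (τ : H3) : pullForm h τ (dz (h • τ)) = jac h τ • dz τ := by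
  rw [← coef_smul_dz (pullForm h τ (dz (h • τ))), coef_pullForm, coef_dz, mul_one]

/-! ### Trivializing a line bundle by a section -/

namespace StackLineBundle

variable {K : Type} [Group K] [MulAction K H3]

/-- The local frame makes each fibre one-dimensional, so any nonzero vector is a basis: it is a
nonzero multiple `a` of the frame vector, and coordinates change by division by `a`. -/
theorem bijective_smul (L : StackLineBundle K) {τ : H3} {v : L.Fib τ} (hv : v ≠ 0) :
    Function.Bijective fun c : ℂ => c • v := by
  obtain ⟨e, W, -, hτ, hb, -⟩ := L.frame τ
  obtain ⟨a, ha, -⟩ := hb τ hτ v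
  have ha0 : a ≠ 0 := by
    rintro rfl
    exact hv (by rw [← ha, zero_smul])
  refine ⟨fun c d hcd => ?_, fun w => ?_⟩
  · have h : (c * a) • e τ = (d * a) • e τ := by
      rw [mul_smul, mul_smul, ha]
      exact hcd
    exact mul_right_cancel₀ ha0 ((hb τ hτ ((d * a) • e τ)).unique h rfl)
  · obtain ⟨c, hc, -⟩ := hb τ hτ w
    refine ⟨c / a, ?_⟩
    change (c / a) • v = w
    rw [← ha, ← mul_smul, div_mul_cancel₀ c ha0, hc]

/-- In terms of a frame `e`, `s = f e` with `f` holomorphic and nonzero at `τ`. Multiplication by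
`f` preserves holomorphy, and so does division by `f`. This makes the map `g ↦ g s` match the
holomorphic sections of the two bundles in both directions. -/
theorem holAt_smul_iff (L : StackLineBundle K) {s : ∀ τ, L.Fib τ} {τ : H3} (hs : L.HolAt s τ)
    (h0 : s τ ≠ 0) (g : H3 → ℂ) : HolFunAt g τ ↔ L.HolAt (fun x => g x • s x) τ := by
  obtain ⟨e, W, hW, hτ, hb, hh⟩ := L.frame τ
  obtain ⟨f, hf, hfe⟩ := (hh s τ hτ).1 hs
  have hf0 : f τ ≠ 0 := by
    intro h
    exact h0 (by rw [hfe.self_of_nhds, h, zero_smul])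
  rw [hh _ τ hτ]
  constructor
  · intro hg
    refine ⟨fun x => g x * f x, hg.mul hf, hfe.mono fun x hx => ?_⟩
    rw [hx, mul_smul]
  · rintro ⟨F, hF, hFe⟩
    have hfi : HolFunAt (fun x => (f x)⁻¹) τ := AnalyticAt.inv hf (by rwa [ofC_toC])
    -- Continuity gives nonvanishing near `toC τ` in `ℂ³`; pulling back along `toC` moves this to a
    -- neighbourhood in `ℍ³`.
    have hne : ∀ᶠ w in 𝓝 τ, f w ≠ 0 := by
      have h1 := (continuous_toC.tendsto τ).eventually
        (hf.continuousAt.eventually_ne (by rwa [ofC_toC]))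
      simpa only [ofC_toC] using h1
    -- If `g s = F e`, then `g f = F` near `τ` by uniqueness of coordinates in the frame, hence `g =
    -- F / f` there.
    refine (hF.mul hfi).congr ?_
    filter_upwards [hfe, hFe, hne, hW.mem_nhds hτ] with x h1 h2 h3 h4
    have h5 : (g x * f x) • e x = F x • e x := by rw [mul_smul, ← h1, h2]
    rw [← (hb x h4 _).unique h5 rfl, mul_inv_cancel_right₀ h3]

/-- The trivialization `1 ↦ s` given by a nowhere vanishing equivariant holomorphic section. -/
def isoOfSection [HolAction K] (L : StackLineBundle K) (s : ∀ τ, L.Fib τ)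
    (hol : L.IsHolomorphic s) (equiv : L.IsEquivariant s) (h0 : ∀ τ, s τ ≠ 0) :
    Iso (trivial K) L where
  toEquiv τ := LinearEquiv.ofBijective (LinearMap.toSpanSingleton ℂ (L.Fib τ) (s τ))
    (L.bijective_smul (h0 τ))
  hol_iff g τ := L.holAt_smul_iff (hol τ) (h0 τ) g
  comm k τ v := by
    -- The fibre of the trivial bundle is `ℂ` only after unfolding; with `v` read as a scalar,
    -- compatibility reduces to linearity of the pullback and equivariance of `s`.
    let c : ℂ := v
    change c • s τ = L.pull k τ (c • s (k • τ))
    rw [map_smul, equiv k τ]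

theorem isoOfSection_one [HolAction K] (L : StackLineBundle K) (s : ∀ τ, L.Fib τ)
    (hol : L.IsHolomorphic s) (equiv : L.IsEquivariant s) (h0 : ∀ τ, s τ ≠ 0) (τ : H3) :
    (L.isoOfSection s hol equiv h0).toEquiv τ (1 : ℂ) = s τ :=
  one_smul ℂ (s τ)

end StackLineBundle

/-! ### The three properties of the discriminant section -/

theorem isHolomorphic_discSection (X : OrbifoldCase) :
    ((hodgeBundle X).tensorPower 12).IsHolomorphic (discSection X) := by
  intro τ
  -- A single product suffices: the coefficient is the product of discriminants, and all twelve
  -- tensor factors are `dz`, which is holomorphic because its coefficient is constantly 1.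
  refine ⟨1, fun _ x => ∏ i, ModularForm.discriminant (x i), fun _ _ => dz, fun _ => ?_,
    fun _ _ => ?_, Filter.Eventually.of_forall fun x => ?_⟩
  · exact HolFunAt.prod _ fun i _ => holFunAt_discriminant i τ
  · refine (formsHolAt_iff dz τ).2 ?_
    simp only [coef_dz]
    exact holFunAt_const 1 τ
  · rw [Fin.sum_univ_one]
    rfl

theorem isEquivariant_discSection (X : OrbifoldCase) :
    ((hodgeBundle X).tensorPower 12).IsEquivariant (discSection X) := by
  intro q τ
  induction q using QuotientGroup.induction_on with | H k => ?_
  -- On the class of `k`, the descended action is by definition the action of the representative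
  -- `k`, so the claim becomes one about an element of `A⁽³⁾`. Each of the twelve factors then
  -- contributes one `jac`.
  change PiTensorProduct.map (fun _ : Fin 12 => pullForm (k : A3Grp) τ)
    ((∏ i, ModularForm.discriminant (((k : A3Grp) • τ) i)) •
      PiTensorProduct.tprod ℂ fun _ : Fin 12 => dz ((k : A3Grp) • τ)) =
    (∏ i, ModularForm.discriminant (τ i)) • PiTensorProduct.tprod ℂ fun _ : Fin 12 => dz τ
  rw [map_smul, PiTensorProduct.map_tprod, pullForm_dz, MultilinearMap.map_smul_univ, smul_smul,
    Finset.prod_const, Finset.card_univ, Fintype.card_fin, prod_discriminant_smul]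

/-- The product of the coefficient functionals over the `n` factors descends to a linear functional
on the tensor power, and it takes the value 1 on this tensor. -/
theorem tprod_dz_ne_zero (n : ℕ) (τ : H3) :
    (PiTensorProduct.tprod ℂ fun _ : Fin n => dz τ) ≠ 0 := by
  intro h
  have h1 := congrArg (PiTensorProduct.lift
    ((MultilinearMap.mkPiAlgebra ℂ (Fin n) ℂ).compLinearMap fun _ => coef τ)) h
  rw [PiTensorProduct.lift.tprod, map_zero, MultilinearMap.compLinearMap_apply,
    MultilinearMap.mkPiAlgebra_apply, coef_dz, Finset.prod_const_one] at h1
  exact one_ne_zero h1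

theorem discSection_ne_zero (X : OrbifoldCase) (τ : H3) : discSection X τ ≠ 0 :=
  smul_ne_zero (Finset.prod_ne_zero_iff.2 fun i _ => ModularForm.discriminant_ne_zero (τ i))
    (tprod_dz_ne_zero 12 τ)

end ToroidalOrbifold

open ToroidalOrbifold in
theorem theorem6p14 (X : OrbifoldCase) :
    ((hodgeBundle X).tensorPower 12).IsHolomorphic (discSection X) ∧
    ((hodgeBundle X).tensorPower 12).IsEquivariant (discSection X) ∧
    (∀ τ : H3, discSection X τ ≠ 0) ∧
    ∃ Φ : StackLineBundle.Iso (StackLineBundle.trivial (HQuot X))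
        ((hodgeBundle X).tensorPower 12),
      ∀ τ : H3, Φ.toEquiv τ (1 : ℂ) = discSection X τ :=
  ⟨isHolomorphic_discSection X, isEquivariant_discSection X, discSection_ne_zero X,
    StackLineBundle.isoOfSection _ _ (isHolomorphic_discSection X) (isEquivariant_discSection X)
      (discSection_ne_zero X),
    StackLineBundle.isoOfSection_one _ _ _ _ _⟩
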